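/- Let $R$ be a commutative noetherian ring, let $I, J$ be ideals of $R$, and let $M$ be a finitely generated $R$-module. For an $R$-module $N$ put $$\Gamma_{I,J}(N)=\{x\in N \mid I^n x\subseteq Jx \text{ for } n\gg 1\},$$ a submodule of $N$. Let $H^i_{I,J}$ denote the $i$-th right derived functor ($i \ge 0$) of the functor $\Gamma_{I,J}$ on $R$-modules, and put $$W(I,J)=\{\mathfrak p\in\operatorname{Spec}(R) \mid I^n\subseteq J+\mathfrak p \text{ for } n\gg 1\}.$$ Then $$\inf\{\, i \mid H^i_{I,J}(M)\neq 0\,\}=\inf\{\,\operatorname{depth} M_{\mathfrak p} \mid \mathfrak p\in W(I,J)\,\}.$$ Here $\operatorname{depth} M_{\mathfrak p}$ is the supremum of the lengths of $M_{\mathfrak p}$-regular sequences in the maximal ideal of $R_{\mathfrak p}$ if $M_{\mathfrak p}\ne 0$, and $\operatorname{depth} 0=\infty$; the infimum of the empty set is $\infty$. -/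

import Mathlib

open CategoryTheory

universe u

namespace PairLocalCohomology

section Torsion

variable {R : Type u} [CommRing R] (I J : Ideal R)

/-- The set `W(I, J)` of primes `p` with `I ^ n ⊆ J + p` for some `n` (equivalently for all
sufficiently large `n`, since the powers of `I` decrease). -/
def W : Set (PrimeSpectrum R) :=
  {p | ∃ n : ℕ, I ^ n ≤ J + p.asIdeal}

/-- The `(I, J)`-torsion submodule of `M`: the elements `x` with `I ^ n x ⊆ J x` for some `n`
(equivalently for all sufficiently large `n`). Here `𝔞 x = {a x | a ∈ 𝔞}`. -/
def torsion (M : Type*) [AddCommGroup M] [Module R M] : Submodule R M where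
  carrier := {x | ∃ n : ℕ, ∀ a ∈ I ^ n, ∃ b ∈ J, a • x = b • x}
  zero_mem' := ⟨0, fun _ _ => ⟨0, J.zero_mem, by simp⟩⟩
  smul_mem' := by
    rintro r x ⟨n, h⟩
    refine ⟨n, fun a ha => ?_⟩
    obtain ⟨b, hb, e⟩ := h a ha
    exact ⟨b, hb, by rw [smul_comm, e, smul_comm]⟩
  add_mem' := by
    rintro x y ⟨m, hx⟩ ⟨n, hy⟩
    refine ⟨m + n, fun a ha => ?_⟩
    rw [pow_add] at ha
    refine Submodule.mul_induction_on ha ?_ ?_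
    · intro s hs t ht
      obtain ⟨b, hb, eb⟩ := hx s hs
      obtain ⟨c, hc, ec⟩ := hy t ht
      refine ⟨s * c + t * b - b * c, ?_, ?_⟩
      · exact J.sub_mem (J.add_mem (J.mul_mem_left _ hc) (J.mul_mem_left _ hb))
          (J.mul_mem_left _ hc)
      · have h1 : ((s - b) * (t - c)) • x = 0 := by
          rw [mul_comm, mul_smul, sub_smul s, eb, sub_self, smul_zero]
        have h2 : ((s - b) * (t - c)) • y = 0 := by
          rw [mul_smul, sub_smul t, ec, sub_self, smul_zero]
        have h3 : ((s - b) * (t - c)) • (x + y) = 0 := by rw [smul_add, h1, h2, add_zero]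
        rw [← sub_eq_zero, ← sub_smul]
        rw [← h3]
        congr 1
        ring
    · rintro a₁ a₂ ⟨b₁, h₁, e₁⟩ ⟨b₂, h₂, e₂⟩
      exact ⟨b₁ + b₂, J.add_mem h₁ h₂, by rw [add_smul, add_smul, e₁, e₂]⟩

theorem map_mem_torsion {M N : Type*} [AddCommGroup M] [Module R M] [AddCommGroup N] [Module R N]
    (f : M →ₗ[R] N) (x : M) (hx : x ∈ torsion I J M) : f x ∈ torsion I J N := by
  obtain ⟨n, h⟩ := hx
  refine ⟨n, fun a ha => ?_⟩
  obtain ⟨b, hb, e⟩ := h a ha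
  exact ⟨b, hb, by rw [← map_smul, e, map_smul]⟩

/-- The `(I, J)`-torsion functor `Γ_{I,J}` on `R`-modules; a linear map is sent to its restriction
to the torsion submodules. -/
def torsionFunctor : ModuleCat.{u} R ⥤ ModuleCat.{u} R where
  obj M := ModuleCat.of R (torsion I J M)
  map f := ModuleCat.ofHom (f.hom.restrict (map_mem_torsion I J f.hom))

instance torsionFunctor_additive : (torsionFunctor I J).Additive where

/-- The `i`-th local cohomology functor `H^i_{I,J}` with respect to `(I, J)`: the `i`-th right
derived functor of the `(I, J)`-torsion functor. -/
noncomputable def localCohomologyPair (i : ℕ) : ModuleCat.{u} R ⥤ ModuleCat.{u} R :=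
  (torsionFunctor I J).rightDerived i

end Torsion

open Classical in
/-- The depth of a module over a local ring: the supremum of the lengths of the regular sequences on
the module contained in the maximal ideal, with the convention that the zero module has infinite
depth. -/
noncomputable def depth (A : Type*) [CommRing A] [IsLocalRing A]
    (N : Type*) [AddCommGroup N] [Module A N] : ℕ∞ :=
  if Subsingleton N then ⊤
  else ⨆ (rs : List A) (_ : RingTheory.Sequence.IsRegular N rs ∧
    ∀ r ∈ rs, r ∈ IsLocalRing.maximalIdeal A), (rs.length : ℕ∞)

end PairLocalCohomology

/-! For every `n`, `H^i_{I,J}(N)` vanishes for all `i < n` iff `Ext^i(k(p), N_p)` does for all `i <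
n` and `p ∈ W(I,J)`, where `k(p)` is the residue field of `R_p`. For `n = 1` both say that no
associated prime of `N` lies in `W(I,J)`. If so, `N` embeds in a torsion-free injective `E`; `E_p`
is injective as `R` is noetherian, and `Hom(k(p), E_p) = 0` for `p ∈ W(I,J)`. Passing to `E/N` thus
lowers all degrees by one on both sides, and induction applies. For finitely generated `M`, Rees'
theorem turns the Ext condition into a depth bound. -/

open Limits

/-! ### Dimension shifting for right derived functors -/

section DimensionShift

universe v v' u'

variable {C : Type u} [Category.{v} C] [Abelian C]

namespace CategoryTheory.InjectiveResolution

/-- The coaugmentation of an injective resolution, with source the resolved object. -/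
noncomputable def coaugmentation {X : C} (P : InjectiveResolution X) : X ⟶ P.cocomplex.X 0 :=
  P.ι.f 0

instance {X : C} (P : InjectiveResolution X) : Mono P.coaugmentation :=
  inferInstanceAs (Mono (P.ι.f 0))

theorem coaugmentation_comp_d {X : C} (P : InjectiveResolution X) :
    P.coaugmentation ≫ P.cocomplex.d 0 1 = 0 :=
  P.ι_f_zero_comp_complex_d

theorem coaugmentation_exact {X : C} (P : InjectiveResolution X) :
    (ShortComplex.mk P.coaugmentation (P.cocomplex.d 0 1) P.coaugmentation_comp_d).Exact :=
  ShortComplex.exact_of_f_is_kernel _ P.isLimitKernelFork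

/-- Splicing a short exact sequence `0 ⟶ X₁ ⟶ X₂ ⟶ X₃ ⟶ 0` with `X₂` injective and an injective
resolution of `X₃` gives an injective resolution of `X₁`. -/
noncomputable def splice {S : ShortComplex C} (hS : S.ShortExact)
    [Injective S.X₂] (P : InjectiveResolution S.X₃) : InjectiveResolution S.X₁ where
  cocomplex := P.cocomplex.augment (S.g ≫ P.coaugmentation) (by
    rw [Category.assoc, P.coaugmentation_comp_d, comp_zero])
  injective n := by
    cases n
    · assumption
    · exact P.injective _
  ι := (CochainComplex.fromSingle₀Equiv _ _).symm ⟨S.f,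
    (S.zero_assoc P.coaugmentation).trans zero_comp⟩
  quasiIso := ⟨fun n => by
    have := hS.mono_f
    have := hS.epi_g
    rcases n with _ | _ | n
    · rw [CochainComplex.quasiIsoAt₀_iff, ShortComplex.quasiIso_iff_of_zeros]
      · let φ : S ⟶ ShortComplex.mk S.f (S.g ≫ P.coaugmentation)
            (by rw [S.zero_assoc, zero_comp]) :=
          { τ₁ := 𝟙 _, τ₂ := 𝟙 _, τ₃ := P.coaugmentation }
        have : Epi φ.τ₁ := inferInstanceAs (Epi (𝟙 _))
        have : IsIso φ.τ₂ := inferInstanceAs (IsIso (𝟙 _))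
        have : Mono φ.τ₃ := inferInstanceAs (Mono P.coaugmentation)
        have h := (ShortComplex.exact_iff_of_epi_of_isIso_of_mono φ).1 hS.exact
        refine (ShortComplex.exact_and_mono_f_iff_of_iso ?_).2 ⟨h, by dsimp; infer_instance⟩
        exact ShortComplex.isoMk (Iso.refl _) (Iso.refl _) (Iso.refl _)
          ((Category.id_comp S.f).trans <|
            (CochainComplex.fromSingle₀Equiv_symm_apply_f_zero
              (C := P.cocomplex.augment (S.g ≫ P.coaugmentation) _) S.f _).symm.trans
              (Category.comp_id _).symm)
          ((Category.id_comp (S.g ≫ P.coaugmentation)).trans (Category.comp_id _).symm)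
      all_goals rfl
    · rw [quasiIsoAt_iff_exactAt]
      · rw [HomologicalComplex.exactAt_iff' _ 0 1 2 (by simp) (by simp)]
        let φ : ShortComplex.mk (S.g ≫ P.coaugmentation) (P.cocomplex.d 0 1) (by
            rw [Category.assoc, P.coaugmentation_comp_d, comp_zero]) ⟶
            ShortComplex.mk P.coaugmentation (P.cocomplex.d 0 1) P.coaugmentation_comp_d :=
          { τ₁ := S.g, τ₂ := 𝟙 _, τ₃ := 𝟙 _ }
        have : Epi φ.τ₁ := inferInstanceAs (Epi S.g)
        have : IsIso φ.τ₂ := inferInstanceAs (IsIso (𝟙 _))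
        have : Mono φ.τ₃ := inferInstanceAs (Mono (𝟙 _))
        exact (ShortComplex.exact_iff_of_epi_of_isIso_of_mono φ).2 P.coaugmentation_exact
      · apply CochainComplex.exactAt_succ_single_obj
    · rw [quasiIsoAt_iff_exactAt]
      · rw [HomologicalComplex.exactAt_iff' _ (n + 1) (n + 2) (n + 3) (by simp) (by simp)]
        exact P.exact_succ n
      · apply CochainComplex.exactAt_succ_single_obj⟩

variable [EnoughInjectives C] {D : Type u'} [Category.{v'} D] [Abelian D]

theorem isZero_rightDerived_iff {X : C} (P : InjectiveResolution X) (F : C ⥤ D) [F.Additive]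
    (n : ℕ) : IsZero ((F.rightDerived n).obj X) ↔
      ((F.mapHomologicalComplex _).obj P.cocomplex).ExactAt n := by
  rw [HomologicalComplex.exactAt_iff_isZero_homology]
  exact (P.isoRightDerivedObj F n).isZero_iff

end CategoryTheory.InjectiveResolution

variable [EnoughInjectives C] {D : Type u'} [Category.{v'} D] [Abelian D]

/-- Applying `F` to the spliced resolution gives `F(P)` shifted by one, preceded by `F(X₂) = 0`. The
vanishing matters only for `n = 0`, where exactness on either side says that the first differential
of `F(P)` is mono. -/
theorem CategoryTheory.ShortComplex.ShortExact.isZero_rightDerived_succ_iff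
    {S : ShortComplex C} (hS : S.ShortExact) [Injective S.X₂]
    (F : C ⥤ D) [F.Additive] (h : IsZero (F.obj S.X₂)) (n : ℕ) :
    IsZero ((F.rightDerived (n + 1)).obj S.X₁) ↔ IsZero ((F.rightDerived n).obj S.X₃) := by
  let P := injectiveResolution S.X₃
  rw [(P.splice hS).isZero_rightDerived_iff F (n + 1), P.isZero_rightDerived_iff F n]
  rcases n with _ | n
  · rw [HomologicalComplex.exactAt_iff' _ 0 1 2 (by simp) (by simp),
      HomologicalComplex.exactAt_iff' _ 0 0 1 (by simp) (by simp)]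
    rw [ShortComplex.exact_iff_mono _ (h.eq_of_src _ _), ShortComplex.exact_iff_mono]
    · rfl
    · exact ((F.mapHomologicalComplex _).obj P.cocomplex).shape 0 0 (by simp)
  · rw [HomologicalComplex.exactAt_iff' _ (n + 1) (n + 2) (n + 3) (by simp) (by simp),
      HomologicalComplex.exactAt_iff' _ n (n + 1) (n + 2) (by simp) (by simp)]
    rfl

end DimensionShift

/-! ### Dimension shifting for Ext -/

section Ext

open Abelian

variable {C : Type*} [Category C] [Abelian C] [HasExt C]

theorem CategoryTheory.ShortComplex.ShortExact.subsingleton_ext_succ_iff {S : ShortComplex C}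
    (hS : S.ShortExact) [Injective S.X₂] (X : C) (h : Subsingleton (Ext X S.X₂ 0)) (n : ℕ) :
    Subsingleton (Ext X S.X₁ (n + 1)) ↔ Subsingleton (Ext X S.X₃ n) := by
  have h2 : ∀ i, Subsingleton (Ext X S.X₂ i)
    | 0 => h
    | i + 1 => Ext.subsingleton_of_injective X S.X₂ i
  constructor <;> intro h'
  · refine subsingleton_of_forall_eq 0 fun x => ?_
    obtain ⟨y, rfl⟩ := Ext.covariant_sequence_exact₃ X hS x rfl (Subsingleton.elim _ _)
    rw [Subsingleton.elim y 0, Ext.zero_comp]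
  · refine subsingleton_of_forall_eq 0 fun x => ?_
    obtain ⟨y, rfl⟩ := Ext.covariant_sequence_exact₁ X hS x (Subsingleton.elim _ _) rfl
    rw [Subsingleton.elim y 0, Ext.zero_comp]

end Ext

/-! ### Injective submodules of injective modules -/

section Modules

theorem Submodule.exists_le_maximal_disjoint {R M : Type*} [Ring R] [AddCommGroup M] [Module R M]
    {N T : Submodule R M} (h : Disjoint N T) :
    ∃ L, N ≤ L ∧ Maximal (fun L => Disjoint L T) L := by
  obtain ⟨L, hL⟩ := zorn_le_nonempty₀ {L : Submodule R M | Disjoint L T} (fun c hc hchain y hy => by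
    refine ⟨sSup c, ?_, fun L => le_sSup⟩
    have hdir : DirectedOn (· ≤ ·) c := hchain.directedOn
    exact hdir.disjoint_sSup_left.2 fun L hL => hc hL) N h
  exact ⟨L, hL.1, hL.2⟩

/-- In an injective module, a submodule maximal among those disjoint from a given submodule is
injective. -/
theorem Module.Injective.of_maximal_disjoint {R : Type u} {E : Type u} [Ring R] [AddCommGroup E]
    [Module R E] [Module.Injective R E] {L T : Submodule R E}
    (hL : Maximal (fun L => Disjoint L T) L) : Module.Injective R L := by
  -- For `K` maximal among submodules disjoint from `L`, the map `L → E/K` is an essential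
  -- embedding. The inclusion `L → E` extends along it to `g`, which is injective with image still
  -- disjoint from `T`. Maximality of `L` forces `range g = L`, so `L` is a retract of `E`.
  obtain ⟨K, -, hK⟩ := Submodule.exists_le_maximal_disjoint (N := (⊥ : Submodule R E)) (T := L)
    disjoint_bot_left
  let q : L →ₗ[R] E ⧸ K := K.mkQ ∘ₗ L.subtype
  have hq : Function.Injective q := by
    rw [← LinearMap.ker_eq_bot, LinearMap.ker_comp, Submodule.ker_mkQ]
    rw [← Submodule.disjoint_iff_comap_eq_bot]
    exact hK.prop.symm
  -- submodules of the quotient that avoid the image of `L` vanish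
  have hess : ∀ X : Submodule R (E ⧸ K), Disjoint X (LinearMap.range q) → X = ⊥ := by
    intro X hX
    have hKX : K ≤ X.comap K.mkQ := by
      exact K.ker_mkQ.ge.trans (LinearMap.ker_le_comap _)
    have hdis : Disjoint (X.comap K.mkQ) L := by
      refine Submodule.disjoint_def.2 fun x hx hxL => ?_
      have h0 : q ⟨x, hxL⟩ = 0 := Submodule.disjoint_def.1 hX _ hx ⟨_, rfl⟩
      exact congrArg Subtype.val (hq (h0.trans (map_zero q).symm))
    have hcomap := hK.eq_of_le hdis hKX
    rw [← Submodule.map_comap_eq_of_surjective K.mkQ_surjective X, ← hcomap, Submodule.mkQ_map_self]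
  obtain ⟨g, hg⟩ := Module.Injective.extension_property R E L (E ⧸ K) q hq L.subtype
  have hginj : LinearMap.ker g = ⊥ := by
    refine hess _ (Submodule.disjoint_def.2 ?_)
    rintro _ hx ⟨y, rfl⟩
    have hy : g (q y) = y := LinearMap.congr_fun hg y
    rw [LinearMap.mem_ker, hy] at hx
    rw [show y = 0 from Subtype.ext hx, map_zero]
  have hLg : L ≤ LinearMap.range g := fun y hy =>
    ⟨q ⟨y, hy⟩, LinearMap.congr_fun hg ⟨y, hy⟩⟩
  have hdisj : Disjoint (LinearMap.range g) T := by
    have h0 := hess (T.comap g) (Submodule.disjoint_def.2 ?_)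
    · refine Submodule.disjoint_def.2 ?_
      rintro _ ⟨x, rfl⟩ hx
      have hx' : x ∈ T.comap g := hx
      rw [h0, Submodule.mem_bot] at hx'
      rw [hx', map_zero]
    · rintro _ hx ⟨y, rfl⟩
      have hy : g (q y) = y := LinearMap.congr_fun hg y
      rw [Submodule.mem_comap, hy] at hx
      rw [show y = 0 from Subtype.ext (Submodule.disjoint_def.1 hL.prop _ y.2 hx), map_zero]
  have hrange : LinearMap.range g = L := (hL.eq_of_le hdisj hLg).symm
  let r : E →ₗ[R] L := (g ∘ₗ K.mkQ).codRestrict L fun x => hrange ▸ ⟨_, rfl⟩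
  have hr : ∀ x : L, r x = x := fun x => Subtype.ext (LinearMap.congr_fun hg x)
  refine ⟨fun X Y _ _ _ _ f hf k => ?_⟩
  obtain ⟨h, hh⟩ := Module.Injective.out f hf (L.subtype ∘ₗ k)
  exact ⟨r ∘ₗ h, fun x => by simp [hh, hr]⟩

end Modules

namespace PairLocalCohomology

/-! ### Torsion and associated primes -/

section Torsion

variable {R : Type u} [CommRing R] (I J : Ideal R)

theorem mem_torsion_iff {N : Type*} [AddCommGroup N] [Module R N] {x : N} :
    x ∈ torsion I J N ↔ ∃ n : ℕ, ∀ a ∈ I ^ n, ∃ b ∈ J, a • x = b • x :=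
  Iff.rfl

theorem mem_torsion_iff_exists_le {N : Type*} [AddCommGroup N] [Module R N] {x : N} :
    x ∈ torsion I J N ↔ ∃ n : ℕ, I ^ n ≤ J + (⊥ : Submodule R N).colon {x} := by
  rw [mem_torsion_iff]
  refine exists_congr fun n => forall₂_congr fun a _ => ?_
  rw [Submodule.add_eq_sup, Submodule.mem_sup]
  constructor
  · rintro ⟨b, hb, h⟩
    refine ⟨b, hb, a - b, ?_, by ring⟩
    rw [Submodule.mem_colon_singleton, sub_smul, h, sub_self]
    exact Submodule.zero_mem _
  · rintro ⟨b, hb, c, hc, rfl⟩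
    rw [Submodule.mem_colon_singleton, Submodule.mem_bot] at hc
    exact ⟨b, hb, by rw [add_smul, hc, add_zero]⟩

theorem map_mem_torsion_iff {M N : Type*} [AddCommGroup M] [Module R M] [AddCommGroup N]
    [Module R N] {f : M →ₗ[R] N} (hf : Function.Injective f) {x : M} :
    f x ∈ torsion I J N ↔ x ∈ torsion I J M := by
  simp only [mem_torsion_iff, ← map_smul, hf.eq_iff]

theorem disjoint_torsion_iff {N : Type*} [AddCommGroup N] [Module R N] {L : Submodule R N} :
    Disjoint L (torsion I J N) ↔ torsion I J L = ⊥ := by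
  rw [Submodule.disjoint_def, Submodule.eq_bot_iff]
  constructor
  · intro h x hx
    exact Subtype.ext (h x x.2 ((map_mem_torsion_iff I J L.subtype_injective).2 hx))
  · intro h x hx hx'
    exact congrArg Subtype.val
      (h ⟨x, hx⟩ ((map_mem_torsion_iff I J L.subtype_injective (x := ⟨x, hx⟩)).1 hx'))

/-- Over a noetherian ring the annihilator of a nonzero `x` lies in an associated prime, which is in
`W(I,J)` when `x` is torsion. -/
theorem torsion_eq_bot_iff [IsNoetherianRing R] {N : Type*} [AddCommGroup N] [Module R N] :
    torsion I J N = ⊥ ↔ ∀ p ∈ W I J, ¬ IsAssociatedPrime p.asIdeal N := by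
  rw [Submodule.eq_bot_iff]
  constructor
  · rintro h p ⟨n, hn⟩ hp
    obtain ⟨hprime, x, hx⟩ := isAssociatedPrime_iff.1 hp
    have h0 : x = 0 := h x ((mem_torsion_iff_exists_le I J).2 ⟨n, hx ▸ hn⟩)
    refine hprime.ne_top ?_
    simp [hx, h0]
  · intro h x hx
    by_contra h0
    obtain ⟨P, hP, hle⟩ := exists_le_isAssociatedPrime_of_isNoetherianRing R x h0
    obtain ⟨n, hn⟩ := (mem_torsion_iff_exists_le I J).1 hx
    exact h ⟨P, hP.isPrime⟩ ⟨n, hn.trans (sup_le_sup_left hle J)⟩ hP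

theorem isZero_torsionFunctor_obj_iff {N : ModuleCat.{u} R} :
    IsZero ((torsionFunctor I J).obj N) ↔ torsion I J N = ⊥ := by
  rw [ModuleCat.isZero_iff_subsingleton]
  exact Submodule.subsingleton_iff_eq_bot

/-- A module without `(I, J)`-torsion embeds into an injective module without `(I, J)`-torsion. -/
theorem exists_mono_injective_of_torsion_eq_bot {N : ModuleCat.{u} R} (h : torsion I J N = ⊥) :
    ∃ (E : ModuleCat.{u} R) (f : N ⟶ E), Mono f ∧ Injective E ∧ torsion I J E = ⊥ := by
  let E := Injective.under N
  let f : N ⟶ E := Injective.ι N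
  have hf : Function.Injective f.hom := (ModuleCat.mono_iff_injective f).1 inferInstance
  have : Module.Injective R E := by
    rw [Module.injective_iff_injective_object]
    exact inferInstanceAs (Injective E)
  have hN : Disjoint (LinearMap.range f.hom) (torsion I J E) := by
    refine Submodule.disjoint_def.2 ?_
    rintro _ ⟨x, rfl⟩ hx
    have hx' := (map_mem_torsion_iff I J hf).1 hx
    rw [h, Submodule.mem_bot] at hx'
    rw [hx', map_zero]
  obtain ⟨L, hNL, hL⟩ := Submodule.exists_le_maximal_disjoint hN
  have := Module.Injective.of_maximal_disjoint hL
  refine ⟨ModuleCat.of R L, ModuleCat.ofHom (f.hom.codRestrict L fun x => hNL ⟨x, rfl⟩),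
    ?_, Module.injective_object_of_injective_module R L, (disjoint_torsion_iff I J).1 hL.prop⟩
  rw [ModuleCat.mono_iff_injective]
  exact fun x y hxy => hf (congrArg Subtype.val hxy)

/-- Left exactness identifies `H^0_{I,J}` with the torsion functor. -/
instance : PreservesFiniteLimits (torsionFunctor I J) := by
  refine ((Functor.preservesFiniteLimits_tfae (torsionFunctor I J)).out 0 3).1 fun S hS => ?_
  have hf : Function.Injective S.f.hom := (ModuleCat.mono_iff_injective _).1 hS.mono_f
  constructor
  · rw [ShortComplex.ShortExact.moduleCat_exact_iff_function_exact]
    have hex := (ShortComplex.ShortExact.moduleCat_exact_iff_function_exact _).1 hS.exact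
    rintro ⟨y, hy⟩
    constructor
    · intro h
      obtain ⟨x, rfl⟩ := (hex y).1 (congrArg Subtype.val h)
      exact ⟨⟨x, (map_mem_torsion_iff I J hf).1 hy⟩, rfl⟩
    · rintro ⟨x, hx⟩
      rw [← hx]
      exact Subtype.ext (S.moduleCat_zero_apply x.1)
  · rw [ModuleCat.mono_iff_injective]
    exact fun x y hxy => Subtype.ext (hf (congrArg Subtype.val hxy))

theorem isZero_localCohomologyPair_zero_iff {N : ModuleCat.{u} R} :
    IsZero ((localCohomologyPair I J 0).obj N) ↔ torsion I J N = ⊥ := by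
  rw [← isZero_torsionFunctor_obj_iff]
  exact ((torsionFunctor I J).rightDerivedZeroIsoSelf.app N).isZero_iff

end Torsion

/-! ### Depth via Ext from the residue field -/

section Depth

open Abelian IsLocalRing

variable {A : Type u} [CommRing A] [IsLocalRing A]

/-- The residue field is simple, so a nonzero map out of it is an embedding. -/
theorem subsingleton_ext_residue_zero_iff [IsNoetherianRing A] (N : ModuleCat.{u} A) :
    Subsingleton (Ext (ModuleCat.of A (A ⧸ maximalIdeal A)) N 0) ↔
      ¬ IsAssociatedPrime (maximalIdeal A) N := by
  rw [(Ext.addEquiv₀.trans ModuleCat.homAddEquiv).toEquiv.subsingleton_congr,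
    isAssociatedPrime_iff_exists_injective_linearMap]
  constructor
  · rintro h ⟨-, f, hf⟩
    have h1 : f 1 = f 0 := by
      rw [show f = 0 from h.elim _ _]; rfl
    exact one_ne_zero (hf h1)
  · intro h
    refine subsingleton_of_forall_eq 0 fun f => ?_
    have : IsSimpleModule A (A ⧸ maximalIdeal A) :=
      isSimpleModule_iff_isCoatom.2 (IsLocalRing.maximalIdeal.isMaximal A).out
    by_contra h0
    exact h ⟨inferInstance, f, (LinearMap.injective_or_eq_zero f).resolve_right h0⟩

theorem depth_congr {M N : Type*} [AddCommGroup M] [Module A M] [AddCommGroup N] [Module A N]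
    (e : M ≃ₗ[A] N) : depth A M = depth A N := by
  simp only [depth, e.isRegular_congr]
  congr 1
  exact propext e.toEquiv.subsingleton_congr

theorem natCast_le_depth_iff [IsNoetherianRing A] (N : ModuleCat.{u} A) [Module.Finite A N]
    (n : ℕ) : (n : ℕ∞) ≤ depth A N ↔
      ∀ i < n, Subsingleton (Ext (ModuleCat.of A (A ⧸ maximalIdeal A)) N i) := by
  by_cases hN : Subsingleton N
  · simp only [depth, hN, if_true, le_top, true_iff]
    have h0 : IsZero N := ModuleCat.isZero_of_subsingleton N
    intro i _
    refine subsingleton_of_forall_eq 0 fun x => ?_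
    rw [← x.comp_mk₀_id, h0.eq_of_src (𝟙 N) 0, Ext.mk₀_zero, Ext.comp_zero]
  -- Nakayama's lemma; both directions of Rees' theorem need it.
  have hlt : maximalIdeal A • (⊤ : Submodule A N) < ⊤ := by
    have : Nontrivial N := not_subsingleton_iff_nontrivial.1 hN
    refine lt_top_iff_ne_top.2 fun h => ?_
    exact top_ne_bot (Submodule.eq_bot_of_le_smul_of_le_jacobson_bot _ _ Module.Finite.fg_top h.ge
      (maximalIdeal_le_jacobson _))
  have hsupp : Module.support A (A ⧸ maximalIdeal A) =
      PrimeSpectrum.zeroLocus (maximalIdeal A : Set A) := by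
    rw [Module.support_eq_zeroLocus, Ideal.annihilator_quotient]
  rw [depth, if_neg hN]
  constructor
  · intro h i hi
    have hi' : (i : ℕ∞) < n := by exact_mod_cast hi
    obtain ⟨rs, hrs⟩ := lt_iSup_iff.1 (hi'.trans_le h)
    obtain ⟨⟨hreg, hmem⟩, hlen⟩ := lt_iSup_iff.1 hrs
    exact ModuleCat.subsingleton_ext_of_exists_isRegular (maximalIdeal A) _ hsupp.le N hlt rs hmem
      hreg i (by exact_mod_cast hlen)
  · intro h
    obtain ⟨rs, rfl, hmem, hreg⟩ := ModuleCat.exists_isRegular_of_exists_subsingleton_ext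
      (maximalIdeal A) n N hlt (ModuleCat.of A (A ⧸ maximalIdeal A)) hsupp h
    exact le_iSup₂_of_le rs ⟨hreg, hmem⟩ le_rfl

end Depth

/-! ### The comparison by induction -/

section Main

open Abelian IsLocalRing

variable {R : Type u} [CommRing R] [IsNoetherianRing R] (I J : Ideal R)

theorem isAssociatedPrime_localizedModule_iff (p : PrimeSpectrum R) (N : ModuleCat.{u} R) :
    IsAssociatedPrime (maximalIdeal (Localization.AtPrime p.asIdeal))
      (N.localizedModule p.asIdeal.primeCompl) ↔ IsAssociatedPrime p.asIdeal N := by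
  have h := Module.associatedPrimes.preimage_comap_associatedPrimes_eq_associatedPrimes_of_isLocalizedModule
    p.asIdeal.primeCompl (R' := Localization.AtPrime p.asIdeal)
    (N.localizedModuleMkLinearMap p.asIdeal.primeCompl)
  have h' := Set.ext_iff.1 h (maximalIdeal (Localization.AtPrime p.asIdeal))
  rw [Set.mem_preimage] at h'
  simpa [Localization.AtPrime.under_maximalIdeal, AssociatedPrimes.mem_iff] using h'.symm

/-- `N` is arbitrary because the cokernel of `N → E` need not be finitely generated. -/
theorem isZero_localCohomologyPair_iff (n : ℕ) (N : ModuleCat.{u} R) :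
    (∀ i < n, IsZero ((localCohomologyPair I J i).obj N)) ↔
      ∀ p ∈ W I J, ∀ i < n, Subsingleton (Ext
        (ModuleCat.of (Localization.AtPrime p.asIdeal)
          (Localization.AtPrime p.asIdeal ⧸ maximalIdeal (Localization.AtPrime p.asIdeal)))
        (N.localizedModule p.asIdeal.primeCompl) i) := by
  have key (N : ModuleCat.{u} R) : torsion I J N = ⊥ ↔ ∀ p ∈ W I J, Subsingleton (Ext
        (ModuleCat.of (Localization.AtPrime p.asIdeal)
          (Localization.AtPrime p.asIdeal ⧸ maximalIdeal (Localization.AtPrime p.asIdeal)))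
        (N.localizedModule p.asIdeal.primeCompl) 0) := by
    rw [torsion_eq_bot_iff]
    refine forall₂_congr fun p _ => ?_
    rw [subsingleton_ext_residue_zero_iff, isAssociatedPrime_localizedModule_iff]
  induction n generalizing N with
  | zero => simp
  | succ n ih =>
    by_cases h : torsion I J N = ⊥
    · obtain ⟨E, f, _, _, hE⟩ := exists_mono_injective_of_torsion_eq_bot I J h
      let S := ShortComplex.mk f (cokernel.π f) (cokernel.condition f)
      have hS : S.ShortExact := { exact := ShortComplex.exact_cokernel f }
      have : Injective S.X₂ := ‹Injective E›
      have h1 := hS.isZero_rightDerived_succ_iff (torsionFunctor I J)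
        ((isZero_torsionFunctor_obj_iff I J).2 hE)
      have h2 (p) (hp : p ∈ W I J) :=
        have hSp := hS.map_of_exact (ModuleCat.localizedModuleFunctor p.asIdeal.primeCompl)
        have : Injective (S.map (ModuleCat.localizedModuleFunctor p.asIdeal.primeCompl)).X₂ :=
          (ModuleCat.localizedModuleFunctor.{u} p.asIdeal.primeCompl).injective_obj _
        hSp.subsingleton_ext_succ_iff _ ((key E).1 hE p hp)
      have ih' := ih S.X₃
      have h0 := (isZero_localCohomologyPair_zero_iff I J).2 h
      have h0' := (key N).1 h
      rw [Nat.forall_lt_succ_left, and_iff_right h0]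
      refine (forall₂_congr fun i _ => h1 i).trans (ih'.trans (forall₂_congr fun p hp => ?_))
      rw [Nat.forall_lt_succ_left, and_iff_right (h0' p hp)]
      exact forall₂_congr fun i _ => (h2 p hp i).symm
    -- With nonzero torsion, both sides already fail at `i = 0`.
    · refine iff_of_false (fun H => h ?_) (fun H => h ?_)
      · exact (isZero_localCohomologyPair_zero_iff I J).1 (H 0 n.succ_pos)
      · exact (key N).2 fun p hp => H p hp 0 n.succ_pos

theorem natCast_le_depth_localizedModule_iff (p : PrimeSpectrum R) (M : Type u) [AddCommGroup M]
    [Module R M] [Module.Finite R M] (n : ℕ) :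
    (n : ℕ∞) ≤ depth (Localization.AtPrime p.asIdeal) (LocalizedModule.AtPrime p.asIdeal M) ↔
      ∀ i < n, Subsingleton (Ext
        (ModuleCat.of (Localization.AtPrime p.asIdeal)
          (Localization.AtPrime p.asIdeal ⧸ maximalIdeal (Localization.AtPrime p.asIdeal)))
        ((ModuleCat.of R M).localizedModule p.asIdeal.primeCompl) i) := by
  let e : LocalizedModule.AtPrime p.asIdeal M ≃ₗ[Localization.AtPrime p.asIdeal]
      (ModuleCat.of R M).localizedModule p.asIdeal.primeCompl :=
    (Shrink.linearEquiv (Localization.AtPrime p.asIdeal) _).symm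
  have : Module.Finite (Localization.AtPrime p.asIdeal)
      ((ModuleCat.of R M).localizedModule p.asIdeal.primeCompl) :=
    Module.Finite.equiv e
  rw [depth_congr e, natCast_le_depth_iff]

end Main

end PairLocalCohomology

/-- Both infima are taken in `ℕ∞`, where the infimum of the empty set is `⊤`. -/
theorem theorem4p1 {R : Type u} [CommRing R] [IsNoetherianRing R] (I J : Ideal R)
    (M : Type u) [AddCommGroup M] [Module R M] [Module.Finite R M] :
    (⨅ (i : ℕ) (_ : ¬ Limits.IsZero
        ((PairLocalCohomology.localCohomologyPair I J i).obj (ModuleCat.of R M))), (i : ℕ∞)) =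
      ⨅ p ∈ PairLocalCohomology.W I J,
        PairLocalCohomology.depth (Localization.AtPrime p.asIdeal)
          (LocalizedModule.AtPrime p.asIdeal M) := by
  refine ENat.eq_of_forall_natCast_le_iff fun n => ?_
  simp only [le_iInf_iff, PairLocalCohomology.natCast_le_depth_localizedModule_iff,
    ← PairLocalCohomology.isZero_localCohomologyPair_iff, Nat.cast_le]
  refine forall_congr' fun i => ?_
  rw [not_imp_comm, not_le]
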